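/- For integers $n \ge 3$ and $k \ge 2$, let $\mathcal{E}_{n,k}$ be the graph formed by a row of $k$ polygons with $2n$ sides each, consecutive polygons being glued along opposite (parallel) edges. Explicitly, put $m = n-1$. The vertices of $\mathcal{E}_{n,k}$ are $u_0,\dots,u_{km}$ and $l_0,\dots,l_{km}$, and its edges are $u_iu_{i+1}$ and $l_il_{i+1}$ for $0 \le i < km$, together with $u_{jm}l_{jm}$ for $0 \le j \le k$. The perfect matching complex $\mathcal{M}_p(G)$ of a finite simple graph $G$ is the simplicial complex whose faces are the sets of edges of $G$ that are contained in some perfect matching of $G$. **Theorem.** For all integers $n \ge 3$ and $k \ge 2$, (the geometric realization of) the perfect matching complex $\mathcal{M}_p(\mathcal{E}_{n,k})$ is contractible. -/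

import Mathlib

/-- The geometric realization of a simplicial complex `K` on a finite vertex set `ι`: the points of
the standard simplex in `ℝ^ι` (barycentric coordinates) whose support is contained in a face of
`K`, with the subspace topology. -/
def geometricRealization {ι : Type*} [Fintype ι] (K : PreAbstractSimplicialComplex ι) :
    Set (ι → ℝ) :=
  {x | x ∈ stdSimplex ℝ ι ∧ ∃ s ∈ K.faces, ∀ i, x i ≠ 0 → i ∈ s}

/-- The perfect matching complex of a simple graph `G`: its faces are the nonempty finite sets of
edges of `G` that extend to a perfect matching of `G`, so that its facets are the perfect matchings
of `G`. -/
def perfectMatchingComplex {V : Type*} (G : SimpleGraph V) :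
    PreAbstractSimplicialComplex (Sym2 V) where
  faces := {s | s.Nonempty ∧ ∃ M : G.Subgraph, M.IsPerfectMatching ∧ (s : Set (Sym2 V)) ⊆ M.edgeSet}
  isRelLowerSet_faces := by
    rintro s ⟨hs, M, hM, hsM⟩
    exact ⟨hs, fun t hts ht => ⟨ht, M, hM, fun e he => hsM (hts he)⟩⟩

/-- The line tiling of `k` polygons with `2 * n` sides, glued in a row along opposite (parallel)
edges. It has an upper path (row `0`) and a lower path (row `1`), each with `k * (n - 1)` edges and
with its vertices numbered from left to right by `0, …, k * (n - 1)`. The two paths are joined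
by the `k + 1` vertical edges at the positions divisible by `n - 1`. Hence the `j`-th polygon,
`j = 1, …, k`, consists of the `n - 1` upper and the `n - 1` lower edges between the positions
`(j - 1) * (n - 1)` and `j * (n - 1)` and the two vertical edges at these positions. -/
def evenLineTiling (n k : ℕ) : SimpleGraph (Fin 2 × Fin (k * (n - 1) + 1)) :=
  SimpleGraph.fromRel fun v w =>
    (v.1 = w.1 ∧ (v.2 : ℕ) + 1 = (w.2 : ℕ)) ∨
    (v.1 ≠ w.1 ∧ v.2 = w.2 ∧ n - 1 ∣ (v.2 : ℕ))

/-! Write m = n - 1. The alternate edges of the first polygon, starting with the horizontal edges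
ending at m, form a set X. A perfect matching M contains all or none of X
(`adj_iff_of_alternating`), since interior positions have degree two. If X ⊆ M, then position m is
matched to the left, which forces the upper edge b from m + 1 to m + 2 into M. So b dominates every
edge of X, and the identity is contiguous to the map sending X to b and fixing all other edges. What
remains after removing X is a cone with apex c, the upper edge from m - 2 to m - 1. If M avoids X,
then c is forced into M; if X ⊆ M, exchanging X for the complementary alternate edges of the polygon
gives a perfect matching with c, b and M \ X (`flipped`). Hence that map is contiguous to the
constant c, and contiguous maps are homotopic. `exists_dominated_edges` carries the combinatorics.
-/

/-! ### Contiguous vertex maps and homotopies of realizations. -/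

section Contiguity

variable {ι : Type*}

/-- Two vertex maps are contiguous on `K` if they send each face into a common face. -/
def Contiguous (K : PreAbstractSimplicialComplex ι) (φ ψ : ι → ι) : Prop :=
  ∀ s ∈ K.faces, ∃ t ∈ K.faces, ∀ i ∈ s, φ i ∈ t ∧ ψ i ∈ t

variable {K : PreAbstractSimplicialComplex ι} {φ ψ : ι → ι}

/-- Contiguity of a map with itself means that it is simplicial, which is what `realizationMap`
needs. -/
lemma Contiguous.left (h : Contiguous K φ ψ) : Contiguous K φ φ := fun s hs =>
  let ⟨t, ht, hst⟩ := h s hs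
  ⟨t, ht, fun i hi => ⟨(hst i hi).1, (hst i hi).1⟩⟩

lemma Contiguous.right (h : Contiguous K φ ψ) : Contiguous K ψ ψ := fun s hs =>
  let ⟨t, ht, hst⟩ := h s hs
  ⟨t, ht, fun i hi => ⟨(hst i hi).2, (hst i hi).2⟩⟩

end Contiguity

open scoped Classical in
/-- The affine extension to `ℝ^ι` of a map of vertices. -/
noncomputable def pushWeights {ι : Type*} [Fintype ι] (φ : ι → ι) (x : ι → ℝ) : ι → ℝ :=
  fun i => ∑ j, if φ j = i then x j else 0

section Realization

variable {ι : Type*} [Fintype ι]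

lemma continuous_pushWeights (φ : ι → ι) : Continuous (pushWeights φ) := by
  unfold pushWeights
  refine continuous_pi fun i => continuous_finsetSum _ fun j _ => ?_
  split_ifs <;> fun_prop

lemma pushWeights_mem_stdSimplex (φ : ι → ι) {x : ι → ℝ} (hx : x ∈ stdSimplex ℝ ι) :
    pushWeights φ x ∈ stdSimplex ℝ ι := by
  classical
  refine ⟨fun i => Finset.sum_nonneg fun j _ => ?_, ?_⟩
  · split_ifs
    exacts [hx.1 j, le_rfl]
  · unfold pushWeights
    rw [Finset.sum_comm]
    simpa using hx.2

lemma exists_of_pushWeights_ne_zero {φ : ι → ι} {x : ι → ℝ} {i : ι} (h : pushWeights φ x i ≠ 0) :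
    ∃ j, φ j = i ∧ x j ≠ 0 := by
  obtain ⟨j, -, hj⟩ := Finset.exists_ne_zero_of_sum_ne_zero h
  by_cases hji : φ j = i
  · exact ⟨j, hji, by simpa [hji] using hj⟩
  · simp [hji] at hj

lemma pushWeights_id (x : ι → ℝ) : pushWeights id x = x := by
  classical
  funext i
  simp [pushWeights]

lemma pushWeights_const (c : ι) {x y : ι → ℝ} (hx : x ∈ stdSimplex ℝ ι) (hy : y ∈ stdSimplex ℝ ι) :
    pushWeights (fun _ => c) x = pushWeights (fun _ => c) y := by
  classical
  funext i
  by_cases h : c = i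
  · simp [pushWeights, h, hx.2, hy.2]
  · simp [pushWeights, h]

variable {K : PreAbstractSimplicialComplex ι} {φ ψ : ι → ι}

/-- Both images of a point lie in the closed simplex of one common face, which is convex. -/
lemma Contiguous.lineMap_mem (h : Contiguous K φ ψ) {x : ι → ℝ}
    (hx : x ∈ geometricRealization K) (t : unitInterval) :
    (1 - (t : ℝ)) • pushWeights φ x + (t : ℝ) • pushWeights ψ x ∈ geometricRealization K := by
  obtain ⟨hx, s, hs, hxs⟩ := hx
  obtain ⟨u, hu, hsu⟩ := h s hs
  refine ⟨convex_stdSimplex ℝ ι (pushWeights_mem_stdSimplex φ hx) (pushWeights_mem_stdSimplex ψ hx)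
    (by linarith [t.2.2]) t.2.1 (by ring), u, hu, fun i hi => ?_⟩
  by_cases h1 : pushWeights φ x i = 0
  · by_cases h2 : pushWeights ψ x i = 0
    · simp [h1, h2] at hi
    · obtain ⟨j, rfl, hj⟩ := exists_of_pushWeights_ne_zero h2
      exact (hsu j (hxs j hj)).2
  · obtain ⟨j, rfl, hj⟩ := exists_of_pushWeights_ne_zero h1
    exact (hsu j (hxs j hj)).1

lemma Contiguous.pushWeights_mem (h : Contiguous K φ φ) {x : ι → ℝ}
    (hx : x ∈ geometricRealization K) : pushWeights φ x ∈ geometricRealization K := by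
  simpa using h.lineMap_mem hx 0

/-- The self-map of the geometric realization induced by a simplicial vertex map. -/
noncomputable def realizationMap (h : Contiguous K φ φ) :
    C(geometricRealization K, geometricRealization K) where
  toFun x := ⟨pushWeights φ x, h.pushWeights_mem x.2⟩
  continuous_toFun := ((continuous_pushWeights φ).comp continuous_subtype_val).subtype_mk _

lemma Contiguous.homotopic (h : Contiguous K φ ψ) (hφ : Contiguous K φ φ) (hψ : Contiguous K ψ ψ) :
    (realizationMap hφ).Homotopic (realizationMap hψ) := by
  refine ⟨⟨⟨fun p => ⟨_, h.lineMap_mem p.2.2 p.1⟩, ?_⟩, fun x => ?_, fun x => ?_⟩⟩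
  · have h1 := continuous_pushWeights φ
    have h2 := continuous_pushWeights ψ
    exact Continuous.subtype_mk (by fun_prop) _
  · exact Subtype.ext (by simp [realizationMap])
  · exact Subtype.ext (by simp [realizationMap])

lemma geometricRealization_nonempty {s : Finset ι} (hs : s ∈ K.faces) (hne : s.Nonempty) :
    (geometricRealization K).Nonempty := by
  classical
  obtain ⟨i, hi⟩ := hne
  refine ⟨Pi.single i 1, single_mem_stdSimplex ℝ i, s, hs, fun j hj => ?_⟩
  by_cases hji : j = i
  · exact hji ▸ hi
  · simp [hji] at hj

/-- A complex on which the identity is contiguous to a vertex map that is itself contiguous to a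
constant map has contractible realization. -/
theorem contractibleSpace_of_contiguous {c : ι} (hne : (geometricRealization K).Nonempty)
    (h1 : Contiguous K id φ) (h2 : Contiguous K φ fun _ => c) :
    ContractibleSpace (geometricRealization K) := by
  rw [contractible_iff_id_nullhomotopic]
  obtain ⟨y, hy⟩ := hne
  refine ⟨realizationMap h2.right ⟨y, hy⟩, ?_⟩
  have e1 : realizationMap h1.left = ContinuousMap.id _ := by
    ext1 x
    exact Subtype.ext (pushWeights_id _)
  have e2 : realizationMap h2.right =
      ContinuousMap.const _ (realizationMap h2.right ⟨y, hy⟩) := by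
    ext1 x
    exact Subtype.ext (pushWeights_const c x.2.1 hy.1)
  rw [← e1, ← e2]
  exact (h1.homotopic h1.left h2.left).trans (h2.homotopic h2.left h2.right)

end Realization

/-! ### Perfect matchings of the tiling and alternating patterns. -/

section Matching

variable {V : Type*} {G : SimpleGraph V}

/-- The subgraph given by a symmetric relation that matches each vertex with exactly one
neighbour. -/
def SimpleGraph.Subgraph.ofRel (G : SimpleGraph V) (R : V → V → Prop) (hsymm : ∀ v w, R v w → R w v)
    (hadj : ∀ v w, R v w → G.Adj v w) : G.Subgraph where
  verts := Set.univ
  Adj := R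
  adj_sub := hadj _ _
  edge_vert _ := trivial
  symm := ⟨hsymm⟩

lemma isPerfectMatching_ofRel {R : V → V → Prop} (hsymm : ∀ v w, R v w → R w v)
    (hadj : ∀ v w, R v w → G.Adj v w) (hR : ∀ v, ∃! w, R v w) :
    (SimpleGraph.Subgraph.ofRel G R hsymm hadj).IsPerfectMatching :=
  SimpleGraph.Subgraph.isPerfectMatching_iff.2 hR

end Matching

section Tiling

/-- The alternating pattern on the positions `0, …, N` of two parallel paths: it consists of every
other edge of each path, beginning with the edge that ends at `N`, and of the vertical edge at `0`
if these edges miss that position. -/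
def alternating {L : ℕ} (N : ℕ) (v w : Fin 2 × Fin L) : Prop :=
  (v.1 = w.1 ∧ (v.2 : ℕ) + 1 = w.2 ∧ (w.2 : ℕ) ≤ N ∧ Even (N - w.2)) ∨
  (v.1 = w.1 ∧ (w.2 : ℕ) + 1 = v.2 ∧ (v.2 : ℕ) ≤ N ∧ Even (N - v.2)) ∨
  (v.1 ≠ w.1 ∧ (v.2 : ℕ) = 0 ∧ (w.2 : ℕ) = 0 ∧ Even N)

variable {L N : ℕ} {v w : Fin 2 × Fin L}

lemma alternating_symm (h : alternating N v w) : alternating N w v := by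
  rcases h with ⟨h1, h2⟩ | ⟨h1, h2⟩ | ⟨h1, h2, h3, h4⟩
  · exact .inr (.inl ⟨h1.symm, h2⟩)
  · exact .inl ⟨h1.symm, h2⟩
  · exact .inr (.inr ⟨h1.symm, h3, h2, h4⟩)

lemma alternating_le (h : alternating N v w) : (v.2 : ℕ) ≤ N ∧ (w.2 : ℕ) ≤ N := by
  rcases h with h | h | h <;> omega

lemma existsUnique_alternating (hN : N < L) (hv : (v.2 : ℕ) ≤ N) : ∃! w, alternating N v w := by
  obtain ⟨r, i, hi⟩ := v
  simp only [alternating, Nat.even_iff] at *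
  -- The parity of `N - i` decides the partner: to the left if even (across the vertical edge when
  -- `i = 0`), to the right if odd.
  by_cases he : (N - i) % 2 = 0
  · by_cases h0 : i = 0
    · refine ⟨(1 - r, ⟨i, hi⟩), by simp; omega, ?_⟩
      rintro ⟨r', j, hj⟩ h
      simp only [Prod.mk.injEq, Fin.mk.injEq] at *
      omega
    · refine ⟨(r, ⟨i - 1, by omega⟩), by simp; omega, ?_⟩
      rintro ⟨r', j, hj⟩ h
      simp only [Prod.mk.injEq, Fin.mk.injEq] at *
      omega
  · refine ⟨(r, ⟨i + 1, by omega⟩), by simp; omega, ?_⟩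
    rintro ⟨r', j, hj⟩ h
    simp only [Prod.mk.injEq, Fin.mk.injEq] at *
    omega

variable {n k : ℕ}

lemma evenLineTiling_adj {v w : Fin 2 × Fin (k * (n - 1) + 1)} :
    (evenLineTiling n k).Adj v w ↔
      (v.1 = w.1 ∧ (v.2 : ℕ) + 1 = w.2) ∨ (v.1 = w.1 ∧ (w.2 : ℕ) + 1 = v.2) ∨
      (v.1 ≠ w.1 ∧ v.2 = w.2 ∧ n - 1 ∣ (v.2 : ℕ)) := by
  rw [evenLineTiling, SimpleGraph.fromRel_adj]
  constructor
  · rintro ⟨-, (h | h) | (h | ⟨h1, h2, h3⟩)⟩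
    · exact .inl h
    · exact .inr (.inr h)
    · exact .inr (.inl ⟨h.1.symm, h.2⟩)
    · exact .inr (.inr ⟨h1.symm, h2.symm, h2 ▸ h3⟩)
  · rintro (h | h | h)
    · exact ⟨by rintro rfl; omega, .inl (.inl h)⟩
    · exact ⟨by rintro rfl; omega, .inr (.inl ⟨h.1.symm, h.2⟩)⟩
    · exact ⟨by rintro rfl; exact h.1 rfl, .inl (.inr h)⟩

lemma evenLineTiling_adj_of_alternating {v w : Fin 2 × Fin (k * (n - 1) + 1)}
    (h : alternating N v w) : (evenLineTiling n k).Adj v w := by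
  rw [evenLineTiling_adj]
  rcases h with h | h | h
  · exact .inl ⟨h.1, h.2.1⟩
  · exact .inr (.inl ⟨h.1, h.2.1⟩)
  · exact .inr (.inr ⟨h.1, Fin.ext (by omega), by simp [h.2.1]⟩)

lemma exists_isPerfectMatching_evenLineTiling (n k : ℕ) :
    ∃ M : (evenLineTiling n k).Subgraph, M.IsPerfectMatching :=
  ⟨_, isPerfectMatching_ofRel (R := alternating (k * (n - 1))) (fun _ _ => alternating_symm)
    (fun _ _ => evenLineTiling_adj_of_alternating)
    fun v => existsUnique_alternating (by omega) (by omega)⟩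

/-! ### How a perfect matching restricts to the first polygon. -/

/-- The subgraph `M` contains the edge of the row `r` from the position `i` to `i + 1`. -/
def HasHorizontal (M : (evenLineTiling n k).Subgraph) (r : Fin 2) (i : ℕ) : Prop :=
  ∃ v w, v.1 = r ∧ w.1 = r ∧ (v.2 : ℕ) = i ∧ (w.2 : ℕ) = i + 1 ∧ M.Adj v w

variable {M : (evenLineTiling n k).Subgraph}

lemma hasHorizontal_iff {v w : Fin 2 × Fin (k * (n - 1) + 1)} (h : v.1 = w.1)
    (h' : (v.2 : ℕ) + 1 = w.2) : HasHorizontal M v.1 v.2 ↔ M.Adj v w := by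
  refine ⟨?_, fun hM => ⟨v, w, rfl, h.symm, rfl, h'.symm, hM⟩⟩
  rintro ⟨v', w', h1, h2, h3, h4, hM⟩
  have hv : v' = v := Prod.ext h1 (Fin.ext h3)
  have hw : w' = w := Prod.ext (h2.trans h) (Fin.ext (h4.trans h'))
  rwa [← hv, ← hw]

lemma HasHorizontal.not_succ (hM : M.IsPerfectMatching) {r : Fin 2} {i : ℕ}
    (h : HasHorizontal M r i) : ¬ HasHorizontal M r (i + 1) := by
  rintro ⟨v', w', h1', h2', h3', h4', hM'⟩
  obtain ⟨v, w, h1, h2, h3, h4, hvw⟩ := h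
  have hv : v' = w := Prod.ext (h1'.trans h2.symm) (Fin.ext (h3'.trans h4.symm))
  subst hv
  have := (SimpleGraph.Subgraph.isPerfectMatching_iff.1 hM v').unique hM' hvw.symm
  subst this
  omega

/-- A position without a vertical edge has only horizontal neighbours, so its partner lies to the
left or to the right. -/
lemma hasHorizontal_succ_iff (hM : M.IsPerfectMatching) (r : Fin 2) {i : ℕ}
    (hi : i + 1 ≤ k * (n - 1)) (hd : ¬ n - 1 ∣ i + 1) :
    HasHorizontal M r (i + 1) ↔ ¬ HasHorizontal M r i := by
  refine ⟨fun h h' => h'.not_succ hM h, fun h => ?_⟩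
  obtain ⟨w, hw, -⟩ := SimpleGraph.Subgraph.isPerfectMatching_iff.1 hM (r, ⟨i + 1, by omega⟩)
  rcases evenLineTiling_adj.1 hw.adj_sub with h1 | h1 | h1
  · exact ⟨_, w, rfl, h1.1.symm, rfl, h1.2.symm, hw⟩
  · exact absurd ⟨w, _, h1.1.symm, rfl, by simpa using h1.2, rfl, hw.symm⟩ h
  · exact absurd h1.2.2 hd

lemma hasHorizontal_zero_iff (hM : M.IsPerfectMatching) (r : Fin 2) :
    HasHorizontal M r 0 ↔ ¬ M.Adj (0, 0) (1, 0) := by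
  obtain ⟨w, hw, huniq⟩ := SimpleGraph.Subgraph.isPerfectMatching_iff.1 hM (r, 0)
  have hflip : M.Adj (0, 0) (1, 0) ↔ M.Adj (r, 0) (1 - r, 0) := by
    fin_cases r
    · rfl
    · exact M.adj_comm _ _
  rw [hflip]
  constructor
  · rintro ⟨v, w', h1, h2, h3, h4, h5⟩ h
    have hv : v = (r, 0) := Prod.ext h1 (Fin.ext h3)
    rw [hv] at h5
    have := (huniq _ h5).trans (huniq _ h).symm
    simp [this] at h4
  · intro h
    rcases evenLineTiling_adj.1 hw.adj_sub with h1 | h1 | h1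
    · exact ⟨_, w, rfl, h1.1.symm, rfl, h1.2.symm, hw⟩
    · simp at h1
    · have : w = (1 - r, 0) := Prod.ext (by have := h1.1; dsimp at this ⊢; omega) h1.2.1.symm
      exact absurd (this ▸ hw) h

lemma hasHorizontal_iff_even (hM : M.IsPerfectMatching) (hk : 0 < k) (r : Fin 2) {i : ℕ}
    (hi : i < n - 1) : HasHorizontal M r i ↔ (Even i ↔ ¬ M.Adj (0, 0) (1, 0)) := by
  induction i with
  | zero => simp [hasHorizontal_zero_iff hM]
  | succ i ih =>
    have hle : n - 1 ≤ k * (n - 1) := Nat.le_mul_of_pos_left _ hk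
    rw [hasHorizontal_succ_iff hM r (by omega) (Nat.not_dvd_of_pos_of_lt (by omega) hi),
      ih (by omega), Nat.even_add_one]
    tauto

/-- A perfect matching contains either all or none of the alternate edges of the first polygon. -/
lemma adj_iff_of_alternating (hM : M.IsPerfectMatching) (hk : 0 < k)
    {v w : Fin 2 × Fin (k * (n - 1) + 1)} (h : alternating (n - 1) v w) :
    M.Adj v w ↔ (Even (n - 1) ↔ M.Adj (0, 0) (1, 0)) := by
  have key : ∀ v w : Fin 2 × Fin (k * (n - 1) + 1), v.1 = w.1 → (v.2 : ℕ) + 1 = w.2 →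
      (w.2 : ℕ) ≤ n - 1 → Even (n - 1 - w.2) →
      (M.Adj v w ↔ (Even (n - 1) ↔ M.Adj (0, 0) (1, 0))) := by
    intro v w h1 h2 h3 h4
    rw [← hasHorizontal_iff h1 h2, hasHorizontal_iff_even hM hk _ (by omega)]
    have : Even (n - 1) ↔ ¬ Even (v.2 : ℕ) := by
      simp only [Nat.even_iff] at *
      omega
    tauto
  rcases h with ⟨h1, h2, h3, h4⟩ | ⟨h1, h2, h3, h4⟩ | ⟨h1, h2, h3, h4⟩
  · exact key v w h1 h2 h3 h4
  · rw [M.adj_comm]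
    exact key w v h1.symm h2 h3 h4
  · simp only [h4, true_iff]
    obtain ⟨r, i⟩ := v
    obtain ⟨r', j⟩ := w
    obtain rfl : i = 0 := Fin.ext h2
    obtain rfl : j = 0 := Fin.ext h3
    fin_cases r <;> fin_cases r'
    · exact absurd rfl h1
    · rfl
    · exact M.adj_comm _ _
    · exact absurd rfl h1

/-! ### Exchanging the alternate edges of the first polygon. -/

/-- The relation obtained from `M` by exchanging the alternate edges of the first polygon. -/
def flipped (M : (evenLineTiling n k).Subgraph) (v w : Fin 2 × Fin (k * (n - 1) + 1)) : Prop :=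
  alternating (n - 1 - 1) v w ∨ (v.1 ≠ w.1 ∧ (v.2 : ℕ) = n - 1 ∧ (w.2 : ℕ) = n - 1) ∨
    (n - 1 < v.2 ∧ n - 1 < w.2 ∧ M.Adj v w)

lemma flipped_symm {v w : Fin 2 × Fin (k * (n - 1) + 1)} (h : flipped M v w) : flipped M w v := by
  rcases h with h | h | h
  · exact .inl (alternating_symm h)
  · exact .inr (.inl ⟨h.1.symm, h.2.2, h.2.1⟩)
  · exact .inr (.inr ⟨h.2.1, h.1, h.2.2.symm⟩)

lemma evenLineTiling_adj_of_flipped {v w : Fin 2 × Fin (k * (n - 1) + 1)} (h : flipped M v w) :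
    (evenLineTiling n k).Adj v w := by
  rcases h with h | h | h
  · exact evenLineTiling_adj_of_alternating h
  · exact evenLineTiling_adj.2 (.inr (.inr ⟨h.1, Fin.ext (h.2.1.trans h.2.2.symm), by simp [h.2.1]⟩))
  · exact h.2.2.adj_sub

/-- The pattern already matches all positions up to m among themselves, so no edge of `M` leaves
this range. -/
lemma alternating_of_adj (hM : M.IsPerfectMatching) (hk : 0 < k)
    (hA : ∀ v w, alternating (n - 1) v w → M.Adj v w)
    {v w : Fin 2 × Fin (k * (n - 1) + 1)} (h : M.Adj v w) (hv : (v.2 : ℕ) ≤ n - 1) :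
    alternating (n - 1) v w := by
  have hle : n - 1 ≤ k * (n - 1) := Nat.le_mul_of_pos_left _ hk
  obtain ⟨z, hz, -⟩ := existsUnique_alternating (L := k * (n - 1) + 1) (by omega) hv
  rwa [(SimpleGraph.Subgraph.isPerfectMatching_iff.1 hM v).unique h (hA v z hz)]

lemma flipped_of_adj (hM : M.IsPerfectMatching) (hk : 0 < k)
    (hA : ∀ v w, alternating (n - 1) v w → M.Adj v w)
    {v w : Fin 2 × Fin (k * (n - 1) + 1)} (h : M.Adj v w) (hvw : ¬ alternating (n - 1) v w) :
    flipped M v w :=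
  .inr (.inr ⟨not_le.1 fun hv => hvw (alternating_of_adj hM hk hA h hv),
    not_le.1 fun hw => hvw (alternating_symm (alternating_of_adj hM hk hA h.symm hw)), h⟩)

lemma existsUnique_flipped (hM : M.IsPerfectMatching) (hk : 0 < k) (hn : 2 ≤ n)
    (hA : ∀ v w, alternating (n - 1) v w → M.Adj v w) (v : Fin 2 × Fin (k * (n - 1) + 1)) :
    ∃! w, flipped M v w := by
  have hle : n - 1 ≤ k * (n - 1) := Nat.le_mul_of_pos_left _ hk
  rcases lt_trichotomy (v.2 : ℕ) (n - 1) with hv | hv | hv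
  · obtain ⟨w, hw, huniq⟩ :=
      existsUnique_alternating (L := k * (n - 1) + 1) (N := n - 1 - 1) (v := v) (by omega) (by omega)
    refine ⟨w, .inl hw, ?_⟩
    rintro z (h | h | h)
    · exact huniq z h
    · omega
    · omega
  · refine ⟨(1 - v.1, v.2), .inr (.inl ⟨by dsimp; omega, hv, hv⟩), ?_⟩
    rintro z (h | h | h)
    · have := alternating_le h
      omega
    · exact Prod.ext (by have := h.1; dsimp; omega) (Fin.ext (h.2.2.trans hv.symm))
    · omega
  · obtain ⟨w, hw, huniq⟩ := SimpleGraph.Subgraph.isPerfectMatching_iff.1 hM v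
    refine ⟨w, flipped_of_adj hM hk hA hw fun h => ?_, ?_⟩
    · have := alternating_le h
      omega
    · rintro z (h | h | h)
      · have := alternating_le h
        omega
      · omega
      · exact huniq z h.2.2

/-- The first clause makes the identity contiguous to the collapse of `X` onto `b`; the second makes
this collapse contiguous to the constant `c`. -/
theorem exists_dominated_edges (hn : 3 ≤ n) (hk : 2 ≤ k) :
    ∃ (X : Set (Sym2 (Fin 2 × Fin (k * (n - 1) + 1)))) (b c : Sym2 _),
      (∀ M : (evenLineTiling n k).Subgraph, M.IsPerfectMatching →
        ∀ e ∈ M.edgeSet, e ∈ X → b ∈ M.edgeSet) ∧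
      ∀ M : (evenLineTiling n k).Subgraph, M.IsPerfectMatching →
        ∃ M' : (evenLineTiling n k).Subgraph, M'.IsPerfectMatching ∧ c ∈ M'.edgeSet ∧
          ∀ e ∈ M.edgeSet, (e ∉ X → e ∈ M'.edgeSet) ∧ (e ∈ X → b ∈ M'.edgeSet) := by
  have hle : 2 * (n - 1) ≤ k * (n - 1) := Nat.mul_le_mul_right _ hk
  let node (i : ℕ) (hi : i ≤ 2 * (n - 1)) : Fin 2 × Fin (k * (n - 1) + 1) := (0, ⟨i, by omega⟩)
  -- The edge pq lies in the second polygon: `2 ≤ k` provides that polygon, and `3 ≤ n` gives m + 2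
  -- ≤ 2m.
  let p := node (n - 1 + 1) (by omega)
  let q := node (n - 1 + 2) (by omega)
  let v := node (n - 1 - 2) (by omega)
  let w := node (n - 1 - 1) (by omega)
  have hvw : (v.2 : ℕ) + 1 = w.2 := show n - 1 - 2 + 1 = n - 1 - 1 by omega
  have hmeet : ∀ M : (evenLineTiling n k).Subgraph, M.IsPerfectMatching →
      ∀ e ∈ M.edgeSet, (∃ x y, e = s(x, y) ∧ alternating (n - 1) x y) →
      ∀ x y, alternating (n - 1) x y → M.Adj x y := by
    rintro M hM _ he ⟨x, y, rfl, hxy⟩ x' y' hxy'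
    rw [adj_iff_of_alternating hM (by omega) hxy']
    exact (adj_iff_of_alternating hM (by omega) hxy).1 he
  have hpq : ∀ M : (evenLineTiling n k).Subgraph, M.IsPerfectMatching →
      (∀ x y, alternating (n - 1) x y → M.Adj x y) → M.Adj p q := by
    intro M hM hA
    have h1 : HasHorizontal M 0 (n - 1 - 1) :=
      ⟨w, node (n - 1) (by omega), rfl, rfl, rfl, show n - 1 = n - 1 - 1 + 1 by omega,
        hA _ _ (.inl ⟨rfl, show n - 1 - 1 + 1 = n - 1 by omega, le_rfl, by simp [node]⟩)⟩
    have h2 := h1.not_succ hM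
    rw [Nat.sub_add_cancel (by omega)] at h2
    have hd : ¬ n - 1 ∣ n - 1 + 1 := by
      rw [Nat.dvd_add_right (dvd_refl _), Nat.dvd_one]
      omega
    exact (hasHorizontal_iff (v := p) (w := q) rfl rfl).1
      ((hasHorizontal_succ_iff hM 0 (by omega) hd).2 h2)
  refine ⟨{e | ∃ x y, e = s(x, y) ∧ alternating (n - 1) x y}, s(p, q), s(v, w),
    fun M hM e he hX => hpq M hM (hmeet M hM e he hX), fun M hM => ?_⟩
  by_cases hX : ∃ e ∈ M.edgeSet, ∃ x y, e = s(x, y) ∧ alternating (n - 1) x y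
  · obtain ⟨e, he, hX⟩ := hX
    have hA := hmeet M hM e he hX
    refine ⟨_, isPerfectMatching_ofRel (R := flipped M) (fun _ _ => flipped_symm)
      (fun _ _ => evenLineTiling_adj_of_flipped)
      (existsUnique_flipped hM (by omega) (by omega) hA),
      .inl (.inl ⟨rfl, hvw, le_rfl, by simp [w, node]⟩), fun e he => ⟨?_, fun _ => ?_⟩⟩
    · induction e with | _ x y
      exact fun hxy => flipped_of_adj hM (by omega) hA he fun h => hxy ⟨x, y, rfl, h⟩
    · exact .inr (.inr ⟨Nat.lt_succ_self _, show n - 1 < n - 1 + 2 by omega, hpq M hM hA⟩)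
  -- Here `M` itself serves: avoiding the edge from m - 1 to m, it must match m - 1 to m - 2.
  · refine ⟨M, hM, ?_, fun e he => ⟨fun _ => he, fun h => absurd ⟨e, he, h⟩ hX⟩⟩
    refine (hasHorizontal_iff (v := v) (w := w) rfl hvw).1 ?_
    have h1 : ¬ HasHorizontal M 0 (n - 1 - 1) := by
      rintro ⟨x, y, h1, h2, h3, h4, h5⟩
      exact hX ⟨s(x, y), h5, x, y, rfl, .inl ⟨h1.trans h2.symm, by omega, by omega,
        by simp [show (y.2 : ℕ) = n - 1 by omega]⟩⟩
    rw [show n - 1 - 1 = n - 1 - 2 + 1 by omega, hasHorizontal_succ_iff hM 0 (by omega)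
      (Nat.not_dvd_of_pos_of_lt (by omega) (by omega)), not_not] at h1
    exact h1

end Tiling

/-! ### From perfect matchings to contiguity, and the conclusion. -/

section PerfectMatchingComplex

variable {V : Type*} {G : SimpleGraph V}

lemma contiguous_perfectMatchingComplex {φ ψ : Sym2 V → Sym2 V}
    (h : ∀ M : G.Subgraph, M.IsPerfectMatching → ∃ M' : G.Subgraph, M'.IsPerfectMatching ∧
      ∀ e ∈ M.edgeSet, φ e ∈ M'.edgeSet ∧ ψ e ∈ M'.edgeSet) :
    Contiguous (perfectMatchingComplex G) φ ψ := by
  classical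
  rintro s ⟨hne, M, hM, hs⟩
  obtain ⟨M', hM', h'⟩ := h M hM
  refine ⟨s.image φ ∪ s.image ψ, ⟨(hne.image φ).mono Finset.subset_union_left, M', hM', ?_⟩,
    fun e he => ⟨Finset.mem_union_left _ (Finset.mem_image_of_mem φ he),
      Finset.mem_union_right _ (Finset.mem_image_of_mem ψ he)⟩⟩
  intro e he
  rw [Finset.mem_coe, Finset.mem_union, Finset.mem_image, Finset.mem_image] at he
  rcases he with ⟨f, hf, rfl⟩ | ⟨f, hf, rfl⟩
  · exact (h' f (hs hf)).1
  · exact (h' f (hs hf)).2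

end PerfectMatchingComplex

theorem mainTheorem3 (n k : ℕ) (hn : 3 ≤ n) (hk : 2 ≤ k) :
    ContractibleSpace (geometricRealization (perfectMatchingComplex (evenLineTiling n k))) := by
  classical
  obtain ⟨X, b, c, hb, hc⟩ := exists_dominated_edges hn hk
  have hne : (geometricRealization (perfectMatchingComplex (evenLineTiling n k))).Nonempty := by
    obtain ⟨M, hM⟩ := exists_isPerfectMatching_evenLineTiling n k
    obtain ⟨M', hM', hcM', -⟩ := hc M hM
    exact geometricRealization_nonempty (s := {c})
      ⟨Finset.singleton_nonempty c, M', hM', by simpa using hcM'⟩ (Finset.singleton_nonempty c)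
  refine contractibleSpace_of_contiguous (φ := fun e => if e ∈ X then b else e) (c := c) hne
    (contiguous_perfectMatchingComplex fun M hM => ⟨M, hM, fun e he => ⟨he, ?_⟩⟩)
    (contiguous_perfectMatchingComplex fun M hM => ?_)
  · split_ifs with h
    exacts [hb M hM e he h, he]
  · obtain ⟨M', hM', hcM', h'⟩ := hc M hM
    refine ⟨M', hM', fun e he => ⟨?_, hcM'⟩⟩
    split_ifs with h
    exacts [(h' e he).2 h, (h' e he).1 h]
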